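/- Let $k$ be a field. A persistence module is a functor from $(\mathbb{R},\le)$ to $k$-vector spaces; $k_S$ denotes the interval module of an order-convex set $S\subseteq\mathbb{R}$ ($k$ on $S$, $0$ elsewhere, identity structure maps inside $S$), which is $0$ if $S=\emptyset$. Intervals of $\mathbb{R}$ are nonempty and written $\langle a,b\rangle$ with $a<b$ decorated endpoints in $\mathbb{E}=\mathbb{R}\times\{-,+\}\cup\{\pm\infty\}$, ordered with $r^-<r^+<s^-$ for $r<s$ (for instance $\langle r^-,s^+\rangle=[r,s]$ and $\langle r^+,s^-\rangle=(r,s)$). For a persistence module $V$ with structure maps $\rho$, $c\in\mathbb{E}$ and $t\in\mathbb{R}$ put $$\mathrm{Im}^+_{ct}(V)=\bigcap_{s\in\langle c,t^+\rangle}\mathrm{Im}\,\rho_{st},\quad \mathrm{Im}^-_{ct}(V)=\bigcup_{s\in\langle -\infty,c\rangle}\mathrm{Im}\,\rho_{st}\qquad (t\in\langle c,\infty\rangle),$$ $$\mathrm{Ker}^+_{ct}(V)=\bigcap_{r\in\langle c,\infty\rangle}\mathrm{Ker}\,\rho_{tr},\quad \mathrm{Ker}^-_{ct}(V)=\bigcup_{r\in\langle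 t^-,c\rangle}\mathrm{Ker}\,\rho_{tr}\qquad (t\in\langle -\infty,c\rangle),$$ with $\mathrm{Im}^-_{ct}(V)=0$ for $c=-\infty$ and $\mathrm{Ker}^+_{ct}(V)=V(t)$ for $c=\infty$. For an interval $I=\langle a,b\rangle$ and $t\in I$ let $$V^+_{It}=\mathrm{Im}^+_{at}(V)\cap\mathrm{Ker}^+_{bt}(V),\qquad V^-_{It}=\mathrm{Im}^-_{at}(V)\cap\mathrm{Ker}^+_{bt}(V)+\mathrm{Im}^+_{at}(V)\cap\mathrm{Ker}^-_{bt}(V),$$ and $V^\pm_{It}=0$ for $t\notin I$. For a morphism $f:V\to U$ and intervals $I,J$ let $X_{IJ}$ be the persistence module $$X_{IJ}(t)=\frac{Y^+_{IJ}(t)}{Y^-_{IJ}(t)\cap Y^+_{IJ}(t)},\qquad Y^+_{IJ}(t)=f_t(V^+_{It})\cap U^+_{Jt},\qquad Y^-_{IJ}(t)=f_t(V^-_{It})+U^-_{Jt},$$ with structure maps induced by those of $U$. **Proposition.** Let $I$ be an interval, $f:k_I\to U$ a morphism of persistence modules, and $\beta:\bigoplus_{i}k_{J_i}\to U$ a persistence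 basis of $U$ (an isomorphism from a direct sum of interval modules). Let $\mathcal{J}$ be the set of those intervals $J_i$ for which some vector $f_t(x)$ ($t\in\mathbb{R}$, $x\in k_I(t)$) has a nonzero coefficient at $\beta_i$. Write $\tilde J$ for the smallest interval, with respect to inclusion, among the members of $\mathcal{J}$ whose right endpoint is the greatest right endpoint occurring in $\mathcal{J}$. 1. If $f\ne 0$, then $\tilde J$ exists and is unique. 2. For every interval $J$, if $X_{IJ}\neq 0$, then $f\neq 0$ and $J=\tilde J$. 3. If $f\neq 0$, then $X_{I\tilde J}$ is isomorphic to $k_K$ for some (nonempty) interval $K\subseteq I\cap\tilde J$, and there is an injective morphism $X_{I\tilde J}\to k_{I\cap\tilde J}$; that is, $X_{I\tilde J}$ is an interval submodule of $k_{I\cap\tilde J}$. -/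

import Mathlib

open CategoryTheory

universe u

noncomputable section

namespace Persistence

/-! ### Decorated endpoints and intervals of the real line -/

/-- The decorated endpoints `ℝ × {-, +} ∪ {-∞, ∞}`, where `false` stands for the decoration `-` and
`true` for `+`. The order is lexicographic, so that `r⁻ < r⁺ < s⁻` for `r < s`. -/
abbrev Endpoint : Type := WithBot (WithTop (ℝ ×ₗ Bool))

/-- The decorated endpoint `r⁻`. -/
def minusPt (r : ℝ) : Endpoint :=
  (((toLex (r, false) : ℝ ×ₗ Bool) : WithTop (ℝ ×ₗ Bool)) : Endpoint)

/-- The decorated endpoint `r⁺`. -/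
def plusPt (r : ℝ) : Endpoint :=
  (((toLex (r, true) : ℝ ×ₗ Bool) : WithTop (ℝ ×ₗ Bool)) : Endpoint)

/-- The set of reals `⟨a, b⟩` between two decorated endpoints: for instance
`⟨r⁻, s⁺⟩ = [r, s]`, `⟨r⁺, s⁻⟩ = (r, s)` and `⟨-∞, s⁻⟩ = (-∞, s)`. -/
def between (a b : Endpoint) : Set ℝ := {t | a ≤ minusPt t ∧ plusPt t ≤ b}

theorem minusPt_mono : Monotone minusPt := by
  intro s t h
  have : (toLex (s, false) : ℝ ×ₗ Bool) ≤ toLex (t, false) := by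
    rw [Prod.Lex.toLex_le_toLex]
    rcases h.lt_or_eq with h | h
    · exact Or.inl h
    · exact Or.inr ⟨h, le_rfl⟩
  exact WithBot.coe_le_coe.2 (WithTop.coe_le_coe.2 this)

theorem plusPt_mono : Monotone plusPt := by
  intro s t h
  have : (toLex (s, true) : ℝ ×ₗ Bool) ≤ toLex (t, true) := by
    rw [Prod.Lex.toLex_le_toLex]
    rcases h.lt_or_eq with h | h
    · exact Or.inl h
    · exact Or.inr ⟨h, le_rfl⟩
  exact WithBot.coe_le_coe.2 (WithTop.coe_le_coe.2 this)

theorem between_ordConnected (a b : Endpoint) : (between a b).OrdConnected :=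
  ⟨fun _ hx _ hy _ hz => ⟨hx.1.trans (minusPt_mono hz.1), (plusPt_mono hz.2).trans hy.2⟩⟩

/-- A (nonempty) interval of `ℝ`, given by decorated endpoints `left < right`. -/
@[ext] structure Interval where
  left : Endpoint
  right : Endpoint
  left_lt_right : left < right

/-- The set of points of an interval. -/
def Interval.toSet (I : Interval) : Set ℝ := between I.left I.right

instance (I : Interval) : I.toSet.OrdConnected := between_ordConnected _ _

/-! ### Persistence modules indexed over `ℝ` -/

/-- Persistence modules over the field `k`, indexed over `ℝ`; morphisms are natural
transformations. -/
abbrev PersistenceModule (k : Type u) [Field k] := ℝ ⥤ ModuleCat.{u} k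

section

variable {k : Type u} [Field k]

/-- The structure map `V(s) → V(t)` for `s ≤ t`, as a linear map. -/
def PersistenceModule.ρ (V : PersistenceModule k) {s t : ℝ} (h : s ≤ t) :
    V.obj s →ₗ[k] V.obj t := (V.map (homOfLE h)).hom

theorem PersistenceModule.ρ_ρ (V : PersistenceModule k) {s t r : ℝ} (h : s ≤ t) (h' : t ≤ r)
    (x : V.obj s) : PersistenceModule.ρ V h' (PersistenceModule.ρ V h x) =
      PersistenceModule.ρ V (h.trans h') x := by
  have : V.map (homOfLE (h.trans h')) = V.map (homOfLE h) ≫ V.map (homOfLE h') := by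
    rw [← V.map_comp]; rfl
  simp [PersistenceModule.ρ, this]

theorem PersistenceModule.ρ_self (V : PersistenceModule k) {t : ℝ} (h : t ≤ t) (x : V.obj t) :
    PersistenceModule.ρ V h x = x := by
  simp [PersistenceModule.ρ]

theorem PersistenceModule.app_ρ {V U : PersistenceModule k} (f : V ⟶ U) {s t : ℝ} (h : s ≤ t)
    (x : V.obj s) : (f.app t).hom (PersistenceModule.ρ V h x) =
      PersistenceModule.ρ U h ((f.app s).hom x) := by
  simp [PersistenceModule.ρ]

/-! ### Interval modules -/

open Classical in
/-- The space at `t` of the interval module over `S`: it is `k` for `t ∈ S` and `0` otherwise. -/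
def intervalSpace (k : Type u) [Field k] (S : Set ℝ) (t : ℝ) : Submodule k k :=
  if t ∈ S then ⊤ else ⊥

theorem intervalSpace_eq_zero {S : Set ℝ} {t : ℝ} (h : t ∉ S) (x : intervalSpace k S t) :
    (x : k) = 0 := by
  have hS : intervalSpace k S t = ⊥ := if_neg h
  exact (Submodule.mem_bot k).1 (hS.le x.2)

open Classical in
/-- The structure map of the interval module over `S`: it is the identity of `k` if both indices
lie in `S` (and zero otherwise, since then the source or the target is `0`). -/
def intervalMap (k : Type u) [Field k] (S : Set ℝ) (s t : ℝ) :
    intervalSpace k S s →ₗ[k] intervalSpace k S t :=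
  LinearMap.codRestrict _ (if t ∈ S then (intervalSpace k S s).subtype else 0) (by
    intro x
    unfold intervalSpace
    by_cases h : t ∈ S
    · rw [if_pos h]; exact Submodule.mem_top
    · rw [if_neg h, if_neg h]; exact Submodule.zero_mem _)

open Classical in
theorem intervalMap_apply (S : Set ℝ) (s t : ℝ) (x : intervalSpace k S s) :
    (intervalMap k S s t x : k) = if t ∈ S then (x : k) else 0 := by
  by_cases h : t ∈ S <;> simp [intervalMap, h]

/-- The interval module `k_S` of an order-connected set `S` of reals (the zero module if `S` is
empty). -/
def intervalModule (k : Type u) [Field k] (S : Set ℝ) [hS : S.OrdConnected] :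
    PersistenceModule k where
  obj t := ModuleCat.of k (intervalSpace k S t)
  map {s t} _ := ModuleCat.ofHom (intervalMap k S s t)
  map_id t := by
    refine ModuleCat.hom_ext (LinearMap.ext fun x => Subtype.ext ?_)
    change (intervalMap k S t t x : k) = x
    by_cases h : t ∈ S
    · simp [intervalMap_apply, h]
    · simp [intervalMap_apply, h, intervalSpace_eq_zero h x]
  map_comp {s t r} a b := by
    refine ModuleCat.hom_ext (LinearMap.ext fun x => Subtype.ext ?_)
    change (intervalMap k S s r x : k) = intervalMap k S t r (intervalMap k S s t x)
    have hst : s ≤ t := leOfHom a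
    have htr : t ≤ r := leOfHom b
    by_cases hs : s ∈ S
    · by_cases hr : r ∈ S
      · have ht : t ∈ S := hS.out hs hr ⟨hst, htr⟩
        simp [intervalMap_apply, hr, ht]
      · simp [intervalMap_apply, hr]
    · simp [intervalMap_apply, intervalSpace_eq_zero hs x]

/-! ### Direct sums of interval modules and persistence bases -/

/-- The direct sum of a family of persistence modules, computed pointwise. -/
def directSumModule {ι : Type u} (M : ι → PersistenceModule k) : PersistenceModule k where
  obj t := ModuleCat.of k (DirectSum ι fun i => (M i).obj t)
  map {s t} a := ModuleCat.ofHom (DirectSum.lmap fun i => ((M i).map a).hom)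
  map_id t := by
    ext x
    simp
  map_comp a b := by
    ext x
    simp

/-- A persistence basis of `U`: a family of intervals `J i` and an isomorphism
`⨁ i, k_{J i} ≅ U`. -/
structure PersistenceBasis (U : PersistenceModule k) where
  ι : Type u
  J : ι → Interval
  iso : directSumModule (fun i => intervalModule k (J i).toSet) ≅ U

/-- The coefficients of `x ∈ U(t)` in the persistence basis `β`. -/
def PersistenceBasis.coeff {U : PersistenceModule k} (β : PersistenceBasis U) (t : ℝ)
    (x : U.obj t) :
    DirectSum β.ι fun i => (intervalModule k (β.J i).toSet).obj t :=
  (β.iso.inv.app t).hom x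

/-- The set of the intervals that appear in the expression of the image of `f : V → U` in terms of
the persistence basis `β`: those `J i` for which some `f_t(x)` has a nonzero coefficient at `i`. -/
def PersistenceBasis.intervalsOf {V U : PersistenceModule k} (β : PersistenceBasis U)
    (f : V ⟶ U) : Set Interval :=
  {J | ∃ (t : ℝ) (x : V.obj t) (i : β.ι), β.J i = J ∧ β.coeff t ((f.app t).hom x) i ≠ 0}

/-! ### Persistence submodules and subquotients -/

/-- A persistence submodule of `V`: subspaces of all `V(t)` respected by the structure maps. -/
structure PSub (V : PersistenceModule k) where
  space : ∀ t : ℝ, Submodule k (V.obj t)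
  map_mem : ∀ {s t : ℝ} (h : s ≤ t) (x : V.obj s), x ∈ space s →
    PersistenceModule.ρ V h x ∈ space t

/-- The intersection of two persistence submodules. -/
def PSub.inf {V : PersistenceModule k} (P Q : PSub V) : PSub V where
  space t := P.space t ⊓ Q.space t
  map_mem h x hx := ⟨P.map_mem h x hx.1, Q.map_mem h x hx.2⟩

/-- The sum of two persistence submodules. -/
def PSub.sup {V : PersistenceModule k} (P Q : PSub V) : PSub V where
  space t := P.space t ⊔ Q.space t
  map_mem h x hx := by
    obtain ⟨y, hy, z, hz, rfl⟩ := Submodule.mem_sup.1 hx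
    rw [map_add]
    exact Submodule.add_mem_sup (P.map_mem h y hy) (Q.map_mem h z hz)

/-- The image of a persistence submodule under a morphism. -/
def PSub.map {V U : PersistenceModule k} (f : V ⟶ U) (P : PSub V) : PSub U where
  space t := (P.space t).map (f.app t).hom
  map_mem h x hx := by
    obtain ⟨y, hy, rfl⟩ := hx
    exact ⟨_, P.map_mem h y hy, PersistenceModule.app_ρ f h y⟩

/-- The quotient persistence module `P / (Q ∩ P)`. -/
def PSub.quotient {V : PersistenceModule k} (P Q : PSub V) : PersistenceModule k where
  obj t := ModuleCat.of k (P.space t ⧸ (Q.space t ⊓ P.space t).submoduleOf (P.space t))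
  map {s t} a := ModuleCat.ofHom (Submodule.mapQ _ _
    ((PersistenceModule.ρ V (leOfHom a)).restrict fun x hx => P.map_mem (leOfHom a) x hx)
    fun x hx => ⟨Q.map_mem (leOfHom a) _ hx.1, P.map_mem (leOfHom a) _ hx.2⟩)
  map_id t := by
    refine ModuleCat.hom_ext (LinearMap.ext fun x => ?_)
    obtain ⟨x, rfl⟩ := Submodule.Quotient.mk_surjective _ x
    refine congrArg (Submodule.Quotient.mk) ?_
    exact Subtype.ext (PersistenceModule.ρ_self V _ _)
  map_comp a b := by
    refine ModuleCat.hom_ext (LinearMap.ext fun x => ?_)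
    obtain ⟨x, rfl⟩ := Submodule.Quotient.mk_surjective _ x
    refine congrArg (Submodule.Quotient.mk) ?_
    exact Subtype.ext (PersistenceModule.ρ_ρ V _ _ _).symm

/-! ### The operators `Im^±`, `Ker^±` and the submodules `V_I^±`

The suprema below are directed unions of subspaces; over an empty index set they are `0`, and the
infima are the whole space, which are the usual conventions for `c = -∞` and `c = ∞`. -/

/-- `Im⁺_{ct}(V)`, the intersection of `Im ρ_{st}` over `s ∈ ⟨c, t⁺⟩`. -/
def imPlus (V : PersistenceModule k) (c : Endpoint) (t : ℝ) : Submodule k (V.obj t) :=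
  ⨅ (s : ℝ) (h : s ≤ t) (_ : s ∈ between c (plusPt t)), LinearMap.range (PersistenceModule.ρ V h)

/-- `Im⁻_{ct}(V)`, the union of `Im ρ_{st}` over `s ∈ ⟨-∞, c⟩`. -/
def imMinus (V : PersistenceModule k) (c : Endpoint) (t : ℝ) : Submodule k (V.obj t) :=
  ⨆ (s : ℝ) (h : s ≤ t) (_ : s ∈ between ⊥ c), LinearMap.range (PersistenceModule.ρ V h)

/-- `Ker⁺_{ct}(V)`, the intersection of `Ker ρ_{tr}` over `r ∈ ⟨c, ∞⟩`. -/
def kerPlus (V : PersistenceModule k) (c : Endpoint) (t : ℝ) : Submodule k (V.obj t) :=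
  ⨅ (r : ℝ) (h : t ≤ r) (_ : r ∈ between c ⊤), LinearMap.ker (PersistenceModule.ρ V h)

/-- `Ker⁻_{ct}(V)`, the union of `Ker ρ_{tr}` over `r ∈ ⟨t⁻, c⟩`. -/
def kerMinus (V : PersistenceModule k) (c : Endpoint) (t : ℝ) : Submodule k (V.obj t) :=
  ⨆ (r : ℝ) (h : t ≤ r) (_ : r ∈ between (minusPt t) c), LinearMap.ker (PersistenceModule.ρ V h)

theorem imPlus_map (V : PersistenceModule k) (c : Endpoint) {s t : ℝ} (h : s ≤ t) (x : V.obj s)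
    (hx : x ∈ imPlus V c s) : PersistenceModule.ρ V h x ∈ imPlus V c t := by
  simp only [imPlus, Submodule.mem_iInf, LinearMap.mem_range] at hx ⊢
  intro r hr hrc
  rcases le_total r s with hrs | hsr
  · obtain ⟨y, rfl⟩ := hx r hrs ⟨hrc.1, plusPt_mono hrs⟩
    exact ⟨y, (PersistenceModule.ρ_ρ V _ _ _).symm⟩
  · exact ⟨PersistenceModule.ρ V hsr x, PersistenceModule.ρ_ρ V _ _ _⟩

theorem imMinus_map (V : PersistenceModule k) (c : Endpoint) {s t : ℝ} (h : s ≤ t) (x : V.obj s)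
    (hx : x ∈ imMinus V c s) : PersistenceModule.ρ V h x ∈ imMinus V c t := by
  suffices H : imMinus V c s ≤ (imMinus V c t).comap (PersistenceModule.ρ V h) from H hx
  refine iSup_le fun r => iSup_le fun hr => iSup_le fun hrc => ?_
  rintro _ ⟨y, rfl⟩
  rw [Submodule.mem_comap, PersistenceModule.ρ_ρ]
  exact Submodule.mem_iSup_of_mem r (Submodule.mem_iSup_of_mem (hr.trans h)
    (Submodule.mem_iSup_of_mem hrc ⟨y, rfl⟩))

theorem kerPlus_map (V : PersistenceModule k) (c : Endpoint) {s t : ℝ} (h : s ≤ t) (x : V.obj s)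
    (hx : x ∈ kerPlus V c s) : PersistenceModule.ρ V h x ∈ kerPlus V c t := by
  simp only [kerPlus, Submodule.mem_iInf, LinearMap.mem_ker] at hx ⊢
  intro r hr hrc
  rw [PersistenceModule.ρ_ρ]
  exact hx r _ hrc

theorem kerMinus_map (V : PersistenceModule k) (c : Endpoint) {s t : ℝ} (h : s ≤ t) (x : V.obj s)
    (hx : x ∈ kerMinus V c s) : PersistenceModule.ρ V h x ∈ kerMinus V c t := by
  suffices H : kerMinus V c s ≤ (kerMinus V c t).comap (PersistenceModule.ρ V h) from H hx
  refine iSup_le fun r => iSup_le fun hr => iSup_le fun hrc => ?_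
  intro y hy
  rw [LinearMap.mem_ker] at hy
  rw [Submodule.mem_comap]
  rcases le_total r t with hrt | htr
  · have : PersistenceModule.ρ V h y = 0 := by
      rw [← PersistenceModule.ρ_ρ V hr hrt, hy, map_zero]
    rw [this]
    exact Submodule.zero_mem _
  · refine Submodule.mem_iSup_of_mem r (Submodule.mem_iSup_of_mem htr
      (Submodule.mem_iSup_of_mem ⟨minusPt_mono htr, hrc.2⟩ ?_))
    rw [LinearMap.mem_ker, PersistenceModule.ρ_ρ, hy]

theorem kerPlus_eq_zero (V : PersistenceModule k) (I : Interval) {s t : ℝ} (h : s ≤ t)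
    (hs : s ∈ I.toSet) (ht : t ∉ I.toSet) (x : V.obj s) (hx : x ∈ kerPlus V I.right s) :
    PersistenceModule.ρ V h x = 0 := by
  simp only [kerPlus, Submodule.mem_iInf, LinearMap.mem_ker] at hx
  refine hx t h ⟨?_, le_top⟩
  by_contra hlt
  refine ht ⟨hs.1.trans (minusPt_mono h), ?_⟩
  rw [not_le] at hlt
  have key : ∀ b : Endpoint, minusPt t < b → plusPt t ≤ b := by
    intro b hb
    induction b using WithBot.recBotCoe with
    | bot => exact absurd hb (by simp)
    | coe b =>
      induction b using WithTop.recTopCoe with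
      | top => exact le_top
      | coe b =>
        have hb' : (toLex (t, false) : ℝ ×ₗ Bool) < b :=
          WithTop.coe_lt_coe.1 (WithBot.coe_lt_coe.1 hb)
        refine WithBot.coe_le_coe.2 (WithTop.coe_le_coe.2 ?_)
        refine Prod.Lex.le_iff.2 ?_
        rcases Prod.Lex.lt_iff.1 hb' with h1 | ⟨h1, h2⟩
        · exact Or.inl h1
        · refine Or.inr ⟨h1, ?_⟩
          exact (Bool.lt_iff.1 h2).2.symm.le
  exact key _ hlt

open Classical in
/-- The persistence submodule `V_I⁺`: at `t ∈ I = ⟨a, b⟩` it is `Im⁺_{at}(V) ∩ Ker⁺_{bt}(V)`, and it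
is `0` for `t ∉ I`. -/
def VPlus (V : PersistenceModule k) (I : Interval) : PSub V where
  space t := if t ∈ I.toSet then imPlus V I.left t ⊓ kerPlus V I.right t else ⊥
  map_mem {s t} h x hx := by
    by_cases hs : s ∈ I.toSet
    · rw [if_pos hs] at hx
      by_cases ht : t ∈ I.toSet
      · rw [if_pos ht]
        exact ⟨imPlus_map V _ h x hx.1, kerPlus_map V _ h x hx.2⟩
      · rw [if_neg ht, Submodule.mem_bot]
        exact kerPlus_eq_zero V I h hs ht x hx.2
    · rw [if_neg hs, Submodule.mem_bot] at hx
      rw [hx, map_zero]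
      exact Submodule.zero_mem _

theorem kerMinus_le_kerPlus (V : PersistenceModule k) (c : Endpoint) (t : ℝ) :
    kerMinus V c t ≤ kerPlus V c t := by
  refine iSup_le fun r => iSup_le fun hr => iSup_le fun hrc => ?_
  intro y hy
  rw [LinearMap.mem_ker] at hy
  simp only [kerPlus, Submodule.mem_iInf, LinearMap.mem_ker]
  intro r' hr' hrc'
  have hle : r ≤ r' := by
    by_contra hlt
    rw [not_le] at hlt
    have h1 : plusPt r ≤ minusPt r' := hrc.2.trans hrc'.1
    have h2 := Prod.Lex.le_iff.1 (WithTop.coe_le_coe.1 (WithBot.coe_le_coe.1 h1))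
    rcases h2 with h2 | h2
    · exact absurd (show r < r' from h2) hlt.not_gt
    · exact absurd (show r = r' from h2.1) hlt.ne'
  rw [← PersistenceModule.ρ_ρ V hr hle, hy, map_zero]

open Classical in
/-- The persistence submodule `V_I⁻`: at `t ∈ I = ⟨a, b⟩` it is
`Im⁻_{at}(V) ∩ Ker⁺_{bt}(V) + Im⁺_{at}(V) ∩ Ker⁻_{bt}(V)`, and it is `0` for `t ∉ I`. -/
def VMinus (V : PersistenceModule k) (I : Interval) : PSub V where
  space t := if t ∈ I.toSet then
      (imMinus V I.left t ⊓ kerPlus V I.right t) ⊔ (imPlus V I.left t ⊓ kerMinus V I.right t)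
    else ⊥
  map_mem {s t} h x hx := by
    by_cases hs : s ∈ I.toSet
    · rw [if_pos hs] at hx
      obtain ⟨y, hy, z, hz, rfl⟩ := Submodule.mem_sup.1 hx
      rw [map_add]
      by_cases ht : t ∈ I.toSet
      · rw [if_pos ht]
        exact Submodule.add_mem_sup
          ⟨imMinus_map V _ h y hy.1, kerPlus_map V _ h y hy.2⟩
          ⟨imPlus_map V _ h z hz.1, kerMinus_map V _ h z hz.2⟩
      · rw [if_neg ht, kerPlus_eq_zero V I h hs ht y hy.2,
          kerPlus_eq_zero V I h hs ht z (kerMinus_le_kerPlus V _ _ hz.2), add_zero]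
        exact Submodule.zero_mem _
    · rw [if_neg hs, Submodule.mem_bot] at hx
      rw [hx, map_zero]
      exact Submodule.zero_mem _

/-! ### The persistence modules `X_{IJ}` -/

/-- `Y⁺_{IJ} = f V_I⁺ ∩ U_J⁺`. -/
def YPlus {V U : PersistenceModule k} (f : V ⟶ U) (I J : Interval) : PSub U :=
  ((VPlus V I).map f).inf (VPlus U J)

/-- `Y⁻_{IJ} = f V_I⁻ + U_J⁻`. -/
def YMinus {V U : PersistenceModule k} (f : V ⟶ U) (I J : Interval) : PSub U :=
  ((VMinus V I).map f).sup (VMinus U J)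

/-- `X_{IJ} = Y⁺_{IJ} / (Y⁻_{IJ} ∩ Y⁺_{IJ})`. -/
def X {V U : PersistenceModule k} (f : V ⟶ U) (I J : Interval) : PersistenceModule k :=
  (YPlus f I J).quotient (YMinus f I J)

end

/-- `J` is the smallest of the last-ending intervals of the family `𝒥`: it belongs to `𝒥`, no
member of `𝒥` has a greater right endpoint, and `J` is contained in each member of `𝒥` that has the
same right endpoint. -/
def IsSmallestLastEnding (𝒥 : Set Interval) (J : Interval) : Prop :=
  J ∈ 𝒥 ∧ (∀ J' ∈ 𝒥, J'.right ≤ J.right) ∧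
    ∀ J' ∈ 𝒥, J'.right = J.right → J.toSet ⊆ J'.toSet

end Persistence

end

namespace Persistence

/-! ### Decorated endpoints -/

/-! Write `v t` for `imageOne f t`, the image of the generator of `k_I`. As `V_I⁺` is all of `k_I`
on `I` and `V_I⁻ = 0`, `X_{IJ}(t)` is the part of the line spanned by `v t` inside `U_J⁺`, modulo
`U_J⁻`.

The basis turns this into a comparison of endpoints. For `t ∈ J`, a vector lies in `U_J⁺` iff every
`J_i` with nonzero coefficient has both endpoints at most those of `J` (`mem_VPlus_iff`); elements
of `U_J⁻` have no coefficient at `J`, and an element of `U_J⁺` without one is in `U_J⁻`. A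
coefficient of `v` that is nonzero somewhere is nonzero at every point of `I` before the right end
of `J_i` (`coord_imageOne_ne_zero`).

Hence finitely many intervals are active at each time, and those ending after `t` are already
visible at `t`; this gives `J̃`. If `v t` is in `U_J⁺` but not in `U_J⁻`, then `J` is active at `t`
and dominates the others, so `J = J̃`. Conversely `v t` enters `U_{J̃}⁺` once the shorter intervals
have died and stays there until the end of `I ∩ J̃`. On this set `K` the coefficient at `J̃`
identifies `X_{IJ̃}` with `k_K`. -/

theorem minusPt_le_minusPt {s t : ℝ} : minusPt s ≤ minusPt t ↔ s ≤ t := by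
  refine ⟨fun h => ?_, fun h => minusPt_mono h⟩
  rcases Prod.Lex.le_iff.1 (WithTop.coe_le_coe.1 (WithBot.coe_le_coe.1 h)) with h | h
  · exact le_of_lt h
  · exact le_of_eq h.1

theorem plusPt_le_minusPt {s t : ℝ} : plusPt s ≤ minusPt t ↔ s < t := by
  constructor
  · intro h
    rcases Prod.Lex.le_iff.1 (WithTop.coe_le_coe.1 (WithBot.coe_le_coe.1 h)) with h | h
    · exact h
    · exact absurd h.2 (by simp)
  · intro h
    exact WithBot.coe_le_coe.2 (WithTop.coe_le_coe.2 (Prod.Lex.le_iff.2 (Or.inl h)))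

theorem minusPt_lt_plusPt (t : ℝ) : minusPt t < plusPt t :=
  WithBot.coe_lt_coe.2 (WithTop.coe_lt_coe.2 (Prod.Lex.lt_iff.2 (Or.inr ⟨rfl, by simp⟩)))

theorem plusPt_le_of_minusPt_lt {t : ℝ} {b : Endpoint} (hb : minusPt t < b) : plusPt t ≤ b := by
  induction b using WithBot.recBotCoe with
  | bot => exact absurd hb (by simp)
  | coe b =>
    induction b using WithTop.recTopCoe with
    | top => exact le_top
    | coe b =>
      have hb' : (toLex (t, false) : ℝ ×ₗ Bool) < b :=
        WithTop.coe_lt_coe.1 (WithBot.coe_lt_coe.1 hb)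
      refine WithBot.coe_le_coe.2 (WithTop.coe_le_coe.2 (Prod.Lex.le_iff.2 ?_))
      rcases Prod.Lex.lt_iff.1 hb' with h1 | ⟨h1, h2⟩
      · exact Or.inl h1
      · exact Or.inr ⟨h1, (Bool.lt_iff.1 h2).2.symm.le⟩

theorem endpoint_cases (c : Endpoint) :
    c = ⊥ ∨ c = ⊤ ∨ (∃ r, c = minusPt r) ∨ ∃ r, c = plusPt r := by
  induction c using WithBot.recBotCoe with
  | bot => exact Or.inl rfl
  | coe b =>
    induction b using WithTop.recTopCoe with
    | top => exact Or.inr (Or.inl rfl)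
    | coe b =>
      obtain ⟨r, d⟩ := b
      cases d
      · exact Or.inr (Or.inr (Or.inl ⟨r, rfl⟩))
      · exact Or.inr (Or.inr (Or.inr ⟨r, rfl⟩))

/-- Turns a strict inequality of endpoints into a separating real number, the source of most
endpoint comparisons below. -/
theorem between_nonempty {a b : Endpoint} (h : a < b) : (between a b).Nonempty := by
  have key : ∀ {t : ℝ}, a ≤ minusPt t → minusPt t < b → (between a b).Nonempty :=
    fun h1 h2 => ⟨_, h1, plusPt_le_of_minusPt_lt h2⟩
  rcases endpoint_cases a with rfl | rfl | ⟨r, rfl⟩ | ⟨r, rfl⟩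
  · rcases endpoint_cases b with rfl | rfl | ⟨s, rfl⟩ | ⟨s, rfl⟩
    · exact absurd h (lt_irrefl _)
    · exact ⟨0, bot_le, le_top⟩
    · exact ⟨s - 1, bot_le, plusPt_le_minusPt.2 (by linarith)⟩
    · exact ⟨s, bot_le, le_rfl⟩
  · exact absurd h not_top_lt
  · exact key le_rfl h
  · rcases endpoint_cases b with rfl | rfl | ⟨s, rfl⟩ | ⟨s, rfl⟩
    · exact absurd h not_lt_bot
    · exact ⟨r + 1, plusPt_le_minusPt.2 (by linarith), le_top⟩
    · have hrs : r < s :=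
        lt_of_not_ge fun hsr => absurd ((minusPt_lt_plusPt r).trans h)
          (not_lt_of_ge (minusPt_mono hsr))
      obtain ⟨m, h1, h2⟩ := exists_between hrs
      exact ⟨m, plusPt_le_minusPt.2 h1, plusPt_le_minusPt.2 h2⟩
    · have hrs : r < s := lt_of_not_ge fun hsr => absurd h (not_lt_of_ge (plusPt_mono hsr))
      exact ⟨s, plusPt_le_minusPt.2 hrs, le_rfl⟩

theorem lt_of_plusPt_le_of_le_minusPt {s t : ℝ} {c : Endpoint} (h : plusPt s ≤ c)
    (h' : c ≤ minusPt t) : s < t :=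
  plusPt_le_minusPt.1 (h.trans h')

/-- A nonempty upper part of a set `⟨a, d⟩` is an interval. -/
theorem exists_interval_of_upper_part {a d : Endpoint} {K : Set ℝ} (hK : K.Nonempty)
    (hsub : K ⊆ between a d) (hup : ∀ s ∈ K, ∀ t ∈ between a d, s ≤ t → t ∈ K) :
    ∃ L : Interval, L.toSet = K := by
  -- `e` is the infimum of `K`, decorated `-` if attained and `+` if not, or `-∞` if `K` is
  -- unbounded below.
  obtain ⟨e, he⟩ : ∃ e : Endpoint, ∀ t, e ≤ minusPt t ↔ ∃ s ∈ K, s ≤ t := by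
    by_cases hb : BddBelow K
    · by_cases hm : sInf K ∈ K
      · refine ⟨minusPt (sInf K), fun t => minusPt_le_minusPt.trans ⟨fun h => ⟨_, hm, h⟩, ?_⟩⟩
        rintro ⟨s, hs, hst⟩
        exact (csInf_le hb hs).trans hst
      · refine ⟨plusPt (sInf K), fun t => plusPt_le_minusPt.trans ⟨fun h => ?_, ?_⟩⟩
        · obtain ⟨s, hs, hst⟩ := exists_lt_of_csInf_lt hK h
          exact ⟨s, hs, hst.le⟩
        · rintro ⟨s, hs, hst⟩
          refine lt_of_lt_of_le ((csInf_le hb hs).lt_of_ne fun h => hm ?_) hst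
          rwa [h]
    · refine ⟨⊥, fun t => ⟨fun _ => ?_, fun _ => bot_le⟩⟩
      obtain ⟨s, hs, hst⟩ := not_bddBelow_iff.1 hb t
      exact ⟨s, hs, hst.le⟩
  obtain ⟨t₀, ht₀⟩ := hK
  refine ⟨⟨e, d, ((he t₀).2 ⟨t₀, ht₀, le_rfl⟩).trans_lt
    ((minusPt_lt_plusPt t₀).trans_le (hsub ht₀).2)⟩, Set.ext fun t => ⟨?_, fun ht => ?_⟩⟩
  · rintro ⟨h1, h2⟩
    obtain ⟨s, hs, hst⟩ := (he t).1 h1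
    exact hup s hs t ⟨(hsub hs).1.trans (minusPt_mono hst), h2⟩ hst
  · exact ⟨(he t).2 ⟨t, ht, le_rfl⟩, (hsub ht).2⟩

theorem Interval.left_le_of_toSet_subset {J J' : Interval} (h : J.toSet ⊆ J'.toSet) :
    J'.left ≤ J.left := by
  by_contra hlt
  rw [not_le] at hlt
  -- The minimum with `J.right` keeps the point inside `J` while placing it before `J'` starts.
  obtain ⟨s, hs1, hs2⟩ := between_nonempty (lt_min hlt J.left_lt_right)
  have hs : s ∈ J'.toSet := h ⟨hs1, hs2.trans (min_le_right _ _)⟩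
  exact lt_irrefl s (lt_of_plusPt_le_of_le_minusPt (hs2.trans (min_le_left _ _)) hs.1)

theorem IsSmallestLastEnding.eq {𝒥 : Set Interval} {J J' : Interval}
    (h : IsSmallestLastEnding 𝒥 J) (h' : IsSmallestLastEnding 𝒥 J') : J = J' := by
  have hr : J.right = J'.right := le_antisymm (h'.2.1 J h.1) (h.2.1 J' h'.1)
  exact Interval.ext (le_antisymm (Interval.left_le_of_toSet_subset (h'.2.2 J h.1 hr))
    (Interval.left_le_of_toSet_subset (h.2.2 J' h'.1 hr.symm))) hr

section

variable {k : Type u} [Field k]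

/-! ### The submodules `V_I^±` pointwise -/

section

variable (V : PersistenceModule k) {J : Interval} {t : ℝ}

theorem mem_imPlus {c : Endpoint} {x : V.obj t} : x ∈ imPlus V c t ↔
    ∀ (s : ℝ) (h : s ≤ t), s ∈ between c (plusPt t) →
      x ∈ LinearMap.range (PersistenceModule.ρ V h) := by
  simp only [imPlus, Submodule.mem_iInf]

theorem mem_kerPlus {c : Endpoint} {x : V.obj t} : x ∈ kerPlus V c t ↔
    ∀ (r : ℝ) (h : t ≤ r), r ∈ between c ⊤ → PersistenceModule.ρ V h x = 0 := by
  simp only [kerPlus, Submodule.mem_iInf, LinearMap.mem_ker]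

theorem VPlus_space_of_mem (ht : t ∈ J.toSet) :
    (VPlus V J).space t = imPlus V J.left t ⊓ kerPlus V J.right t := if_pos ht

theorem VPlus_space_of_notMem (ht : t ∉ J.toSet) : (VPlus V J).space t = ⊥ := if_neg ht

theorem VMinus_space_of_mem (ht : t ∈ J.toSet) :
    (VMinus V J).space t = (imMinus V J.left t ⊓ kerPlus V J.right t) ⊔
      (imPlus V J.left t ⊓ kerMinus V J.right t) := if_pos ht

theorem VMinus_space_of_notMem (ht : t ∉ J.toSet) : (VMinus V J).space t = ⊥ := if_neg ht

end

/-! ### Coefficients in a persistence basis -/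

namespace PersistenceBasis

variable {U : PersistenceModule k} (β : PersistenceBasis U)

/-- The coefficient at the `i`-th interval as a linear functional. -/
noncomputable def coord (i : β.ι) (t : ℝ) : U.obj t →ₗ[k] k :=
  (intervalSpace k (β.J i).toSet t).subtype ∘ₗ
    DirectSum.component k β.ι (fun i => (intervalModule k (β.J i).toSet).obj t) i ∘ₗ
      (β.iso.inv.app t).hom

open Classical in
/-- The inclusion of the `i`-th summand. -/
noncomputable def vec (i : β.ι) (t : ℝ) : intervalSpace k (β.J i).toSet t →ₗ[k] U.obj t :=
  (β.iso.hom.app t).hom ∘ₗ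
    DirectSum.lof k β.ι (fun i => (intervalModule k (β.J i).toSet).obj t) i

theorem coord_apply (i : β.ι) (t : ℝ) (x : U.obj t) :
    β.coord i t x = (intervalSpace k (β.J i).toSet t).subtype (β.coeff t x i) := rfl

theorem coord_ne_zero_iff (i : β.ι) (t : ℝ) (x : U.obj t) :
    β.coord i t x ≠ 0 ↔ β.coeff t x i ≠ 0 := by
  rw [coord_apply]
  exact not_congr (Submodule.coe_eq_zero (p := intervalSpace k (β.J i).toSet t))

theorem mem_of_coord_ne_zero {i : β.ι} {t : ℝ} {x : U.obj t} (h : β.coord i t x ≠ 0) :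
    t ∈ (β.J i).toSet := by
  by_contra ht
  exact h (intervalSpace_eq_zero ht _)

open Classical in
theorem coord_ρ (i : β.ι) {s t : ℝ} (h : s ≤ t) (x : U.obj s) :
    β.coord i t (PersistenceModule.ρ U h x) =
      if t ∈ (β.J i).toSet then β.coord i s x else 0 := by
  have h1 : β.coeff t (PersistenceModule.ρ U h x) =
      DirectSum.lmap (fun i => ((intervalModule k (β.J i).toSet).map (homOfLE h)).hom)
        (β.coeff s x) := PersistenceModule.app_ρ β.iso.inv h x
  rw [coord_apply, h1, coord_apply]
  exact intervalMap_apply _ _ _ _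

/-- Nothing is asked of `s`: before `J_i` starts the coefficient is zero, so a vector coming from
there has no `i`-th coefficient at `t` either. -/
theorem coord_ρ_of_mem {i : β.ι} {s t : ℝ} (h : s ≤ t) (ht : t ∈ (β.J i).toSet) (x : U.obj s) :
    β.coord i t (PersistenceModule.ρ U h x) = β.coord i s x := by
  rw [coord_ρ, if_pos ht]

theorem finite_coord_ne_zero (t : ℝ) (x : U.obj t) : {i | β.coord i t x ≠ 0}.Finite := by
  classical
  refine (DFinsupp.finite_support (β.coeff t x)).subset fun i hi => ?_
  exact (β.coord_ne_zero_iff i t x).1 hi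

/-- A vector is the finite sum of its components, so membership can be tested on single summands,
and only on those with nonzero coefficient. -/
theorem mem_of_forall_vec_mem {t : ℝ} {x : U.obj t} {P : Submodule k (U.obj t)}
    (h : ∀ i, β.coord i t x ≠ 0 → β.vec i t (β.coeff t x i) ∈ P) : x ∈ P := by
  classical
  have hx : x = (β.iso.hom.app t).hom (β.coeff t x) :=
    (LinearMap.congr_fun (congrArg ModuleCat.Hom.hom (β.iso.inv_hom_id_app t)) x).symm
  rw [hx, ← DirectSum.sum_support_of (β.coeff t x)]
  refine (map_sum (β.iso.hom.app t).hom _ _).symm ▸ Submodule.sum_mem _ fun i hi => h i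
    ((β.coord_ne_zero_iff i t x).2 ((DFinsupp.mem_support_iff).1 hi))

theorem exists_coord_ne_zero {t : ℝ} {x : U.obj t} (h : x ≠ 0) : ∃ i, β.coord i t x ≠ 0 := by
  by_contra! H
  exact h ((Submodule.mem_bot k).1 (β.mem_of_forall_vec_mem fun i hi => absurd (H i) hi))

theorem ρ_vec (i : β.ι) {s t : ℝ} (h : s ≤ t) (x : intervalSpace k (β.J i).toSet s) :
    PersistenceModule.ρ U h (β.vec i s x) = β.vec i t (intervalMap k (β.J i).toSet s t x) := by
  classical
  refine (PersistenceModule.app_ρ β.iso.hom h _).symm.trans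
    (congrArg (β.iso.hom.app t).hom ?_)
  exact DirectSum.lmap_lof (fun i => ((intervalModule k (β.J i).toSet).map (homOfLE h)).hom) i x

theorem ρ_vec_of_notMem (i : β.ι) {s t : ℝ} (h : s ≤ t) (ht : t ∉ (β.J i).toSet)
    (x : intervalSpace k (β.J i).toSet s) : PersistenceModule.ρ U h (β.vec i s x) = 0 := by
  rw [ρ_vec, show intervalMap k (β.J i).toSet s t x = 0 from
    Subtype.ext (intervalSpace_eq_zero ht _), map_zero]

theorem vec_mem_range (i : β.ι) {s t : ℝ} (h : s ≤ t) (hs : s ∈ (β.J i).toSet)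
    (ht : t ∈ (β.J i).toSet) (x : intervalSpace k (β.J i).toSet t) :
    β.vec i t x ∈ LinearMap.range (PersistenceModule.ρ U h) := by
  refine ⟨β.vec i s ⟨x, ?_⟩, ?_⟩
  · rw [intervalSpace, if_pos hs]; exact Submodule.mem_top
  · rw [ρ_vec]
    refine congrArg _ (Subtype.ext ?_)
    rw [intervalMap_apply, if_pos ht]

/-! ### The operators `Im^±` and `Ker^±` in coordinates -/

variable {i : β.ι} {t : ℝ} {c : Endpoint} {x : U.obj t}

/-- If `J_i` started after `c`, then `x` would come from a point between `c` and that start, where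
the coefficient vanishes. -/
theorem left_le_of_mem_imPlus (hx : x ∈ imPlus U c t) (hi : β.coord i t x ≠ 0) :
    (β.J i).left ≤ c := by
  by_contra hlt
  rw [not_le] at hlt
  obtain ⟨s, hs1, hs2⟩ := between_nonempty hlt
  have ht := β.mem_of_coord_ne_zero hi
  have hst : s ≤ t := (lt_of_plusPt_le_of_le_minusPt hs2 ht.1).le
  obtain ⟨y, rfl⟩ := (mem_imPlus U).1 hx s hst ⟨hs1, plusPt_mono hst⟩
  rw [coord_ρ_of_mem β hst ht] at hi
  exact lt_irrefl s (lt_of_plusPt_le_of_le_minusPt hs2 (β.mem_of_coord_ne_zero hi).1)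

theorem left_lt_of_mem_imMinus (hx : x ∈ imMinus U c t) (hi : β.coord i t x ≠ 0) :
    (β.J i).left < c := by
  by_contra hle
  rw [not_lt] at hle
  -- The kernel of the coefficient is a subspace, so it suffices to kill each generating image;
  -- directedness of the union plays no role.
  suffices H : imMinus U c t ≤ LinearMap.ker (β.coord i t) from hi (H hx)
  refine iSup_le fun s => iSup_le fun hst => iSup_le fun hs => ?_
  rintro _ ⟨y, rfl⟩
  rw [LinearMap.mem_ker]
  by_contra hy
  rw [coord_ρ_of_mem β hst (β.mem_of_coord_ne_zero hy)] at hy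
  exact lt_irrefl s (lt_of_plusPt_le_of_le_minusPt (hs.2.trans hle)
    (β.mem_of_coord_ne_zero hy).1)

theorem right_le_of_mem_kerPlus (htc : plusPt t ≤ c) (hx : x ∈ kerPlus U c t)
    (hi : β.coord i t x ≠ 0) : (β.J i).right ≤ c := by
  by_contra hlt
  rw [not_le] at hlt
  obtain ⟨r, hr1, hr2⟩ := between_nonempty hlt
  have htr : t ≤ r := (lt_of_plusPt_le_of_le_minusPt htc hr1).le
  refine hi ?_
  rw [← coord_ρ_of_mem β htr ⟨(β.mem_of_coord_ne_zero hi).1.trans (minusPt_mono htr), hr2⟩,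
    (mem_kerPlus U).1 hx r htr ⟨hr1, le_top⟩, map_zero]

theorem right_lt_of_mem_kerMinus (hx : x ∈ kerMinus U c t) (hi : β.coord i t x ≠ 0) :
    (β.J i).right < c := by
  by_contra hle
  rw [not_lt] at hle
  suffices H : kerMinus U c t ≤ LinearMap.ker (β.coord i t) from hi (H hx)
  refine iSup_le fun r => iSup_le fun htr => iSup_le fun hr => ?_
  intro y hy
  rw [LinearMap.mem_ker] at hy ⊢
  by_contra hy'
  refine hy' ?_
  rw [← coord_ρ_of_mem β htr
    ⟨(β.mem_of_coord_ne_zero hy').1.trans (minusPt_mono htr), hr.2.trans hle⟩, hy, map_zero]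

theorem vec_mem_imPlus (ht : t ∈ (β.J i).toSet) (h : (β.J i).left ≤ c)
    (x : intervalSpace k (β.J i).toSet t) : β.vec i t x ∈ imPlus U c t :=
  (mem_imPlus U).2 fun _ hst hs => β.vec_mem_range i hst ⟨h.trans hs.1, (plusPt_mono hst).trans ht.2⟩ ht x

theorem vec_mem_imMinus (htc : c ≤ minusPt t) (ht : t ∈ (β.J i).toSet) (h : (β.J i).left < c)
    (x : intervalSpace k (β.J i).toSet t) : β.vec i t x ∈ imMinus U c t := by
  obtain ⟨s, hs1, hs2⟩ := between_nonempty h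
  have hst : s ≤ t := (lt_of_plusPt_le_of_le_minusPt hs2 htc).le
  exact Submodule.mem_iSup_of_mem s (Submodule.mem_iSup_of_mem hst (Submodule.mem_iSup_of_mem
    ⟨bot_le, hs2⟩ (β.vec_mem_range i hst ⟨hs1, (plusPt_mono hst).trans ht.2⟩ ht x)))

theorem vec_mem_kerPlus (h : (β.J i).right ≤ c) (x : intervalSpace k (β.J i).toSet t) :
    β.vec i t x ∈ kerPlus U c t :=
  (mem_kerPlus U).2 fun r htr hr => β.ρ_vec_of_notMem i htr
    (fun H => lt_irrefl r (lt_of_plusPt_le_of_le_minusPt (H.2.trans h) hr.1)) x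

theorem vec_mem_kerMinus (ht : t ∈ (β.J i).toSet) (h : (β.J i).right < c)
    (x : intervalSpace k (β.J i).toSet t) : β.vec i t x ∈ kerMinus U c t := by
  obtain ⟨r, hr1, hr2⟩ := between_nonempty h
  have htr : t ≤ r := (lt_of_plusPt_le_of_le_minusPt ht.2 hr1).le
  exact Submodule.mem_iSup_of_mem r (Submodule.mem_iSup_of_mem htr (Submodule.mem_iSup_of_mem
    ⟨minusPt_mono htr, hr2⟩ (LinearMap.mem_ker.2 (β.ρ_vec_of_notMem i htr
      (fun H => lt_irrefl r (lt_of_plusPt_le_of_le_minusPt H.2 hr1)) x))))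

theorem mem_VPlus_iff {J : Interval} (ht : t ∈ J.toSet) :
    x ∈ (VPlus U J).space t ↔
      ∀ i, β.coord i t x ≠ 0 → (β.J i).left ≤ J.left ∧ (β.J i).right ≤ J.right := by
  rw [VPlus_space_of_mem U ht]
  constructor
  · exact fun hx i hi =>
      ⟨β.left_le_of_mem_imPlus hx.1 hi, β.right_le_of_mem_kerPlus ht.2 hx.2 hi⟩
  · intro h
    exact ⟨β.mem_of_forall_vec_mem fun i hi =>
        β.vec_mem_imPlus (β.mem_of_coord_ne_zero hi) (h i hi).1 _,
      β.mem_of_forall_vec_mem fun i hi => β.vec_mem_kerPlus (h i hi).2 _⟩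

/-- Each of the two summands of `U_J⁻` makes one endpoint inequality strict, which `J` itself cannot
satisfy. -/
theorem coord_eq_zero_of_mem_VMinus {J : Interval} (hi : β.J i = J)
    (hx : x ∈ (VMinus U J).space t) : β.coord i t x = 0 := by
  subst hi
  by_cases ht : t ∈ (β.J i).toSet
  · rw [VMinus_space_of_mem U ht] at hx
    obtain ⟨y, hy, z, hz, rfl⟩ := Submodule.mem_sup.1 hx
    have hy0 : β.coord i t y = 0 := by
      by_contra h
      exact lt_irrefl _ (β.left_lt_of_mem_imMinus hy.1 h)
    have hz0 : β.coord i t z = 0 := by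
      by_contra h
      exact lt_irrefl _ (β.right_lt_of_mem_kerMinus hz.2 h)
    rw [map_add, hy0, hz0, add_zero]
  · rw [VMinus_space_of_notMem U ht] at hx
    rw [(Submodule.mem_bot k).1 hx, map_zero]

theorem mem_VMinus_of_forall_ne {J : Interval} (ht : t ∈ J.toSet)
    (hx : x ∈ (VPlus U J).space t) (h : ∀ i, β.coord i t x ≠ 0 → β.J i ≠ J) :
    x ∈ (VMinus U J).space t := by
  rw [β.mem_VPlus_iff ht] at hx
  rw [VMinus_space_of_mem U ht]
  refine β.mem_of_forall_vec_mem fun i hi => ?_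
  have hti := β.mem_of_coord_ne_zero hi
  obtain ⟨hl, hr⟩ := hx i hi
  -- An interval other than `J` is strictly smaller at one endpoint; which one decides the summand
  -- of `U_J⁻` receiving the component.
  rcases hl.lt_or_eq with hl' | hl'
  · exact Submodule.mem_sup_left
      ⟨β.vec_mem_imMinus ht.1 hti hl' _, β.vec_mem_kerPlus hr _⟩
  · refine Submodule.mem_sup_right ⟨β.vec_mem_imPlus hti hl _, β.vec_mem_kerMinus hti ?_ _⟩
    exact hr.lt_of_ne fun hr' => h i hi (Interval.ext hl' hr')

end PersistenceBasis

/-! ### Interval modules -/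

theorem mem_intervalSpace {S : Set ℝ} {t : ℝ} {x : k} (ht : t ∈ S) :
    x ∈ intervalSpace k S t := by
  rw [intervalSpace, if_pos ht]; exact Submodule.mem_top

/-- The morphism to an interval module given by compatible functionals. -/
noncomputable def toIntervalModule {M : PersistenceModule k} (S : Set ℝ) [S.OrdConnected]
    (φ : ∀ t, M.obj t →ₗ[k] k) (hφ : ∀ t x, φ t x ≠ 0 → t ∈ S)
    (hnat : ∀ {s t : ℝ} (h : s ≤ t) (x : M.obj s), t ∈ S →
      φ t (PersistenceModule.ρ M h x) = φ s x) :
    M ⟶ intervalModule k S where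
  app t := ModuleCat.ofHom ((φ t).codRestrict (intervalSpace k S t) fun x => by
    by_cases ht : t ∈ S
    · exact mem_intervalSpace ht
    · rw [not_not.1 (mt (hφ t x) ht)]
      exact Submodule.zero_mem _)
  naturality {s t} a := by
    refine ModuleCat.hom_ext (LinearMap.ext fun x => Subtype.ext ?_)
    change φ t (PersistenceModule.ρ M (leOfHom a) x) =
      ((intervalMap k S s t ⟨φ s x, _⟩ : intervalSpace k S t) : k)
    rw [intervalMap_apply]
    by_cases ht : t ∈ S
    · rw [if_pos ht]
      exact hnat _ x ht
    · rw [if_neg ht]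
      exact not_not.1 (mt (hφ t _) ht)

theorem toIntervalModule_app {M : PersistenceModule k} (S : Set ℝ) [S.OrdConnected]
    (φ : ∀ t, M.obj t →ₗ[k] k) (hφ : ∀ t x, φ t x ≠ 0 → t ∈ S)
    (hnat : ∀ {s t : ℝ} (h : s ≤ t) (x : M.obj s), t ∈ S →
      φ t (PersistenceModule.ρ M h x) = φ s x) (t : ℝ) (x : M.obj t) :
    (intervalSpace k S t).subtype (((toIntervalModule S φ hφ hnat).app t).hom x) = φ t x := rfl

theorem toIntervalModule_injective {M : PersistenceModule k} (S : Set ℝ) [S.OrdConnected]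
    (φ : ∀ t, M.obj t →ₗ[k] k) (hφ : ∀ t x, φ t x ≠ 0 → t ∈ S)
    (hnat : ∀ {s t : ℝ} (h : s ≤ t) (x : M.obj s), t ∈ S →
      φ t (PersistenceModule.ρ M h x) = φ s x) (t : ℝ) (hinj : Function.Injective (φ t)) :
    Function.Injective ((toIntervalModule S φ hφ hnat).app t).hom := fun x y hxy => hinj <| by
  rw [← toIntervalModule_app S φ hφ hnat, hxy, toIntervalModule_app]

theorem isIso_toIntervalModule {M : PersistenceModule k} (S : Set ℝ) [S.OrdConnected]
    (φ : ∀ t, M.obj t →ₗ[k] k) (hφ : ∀ t x, φ t x ≠ 0 → t ∈ S)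
    (hnat : ∀ {s t : ℝ} (h : s ≤ t) (x : M.obj s), t ∈ S →
      φ t (PersistenceModule.ρ M h x) = φ s x) (hinj : ∀ t, Function.Injective (φ t))
    (hS : ∀ t ∈ S, ∃ x, φ t x ≠ 0) : IsIso (toIntervalModule S φ hφ hnat) := by
  have : ∀ t, IsIso ((toIntervalModule S φ hφ hnat).app t) := by
    intro t
    refine (ConcreteCategory.isIso_iff_bijective _).2
      ⟨toIntervalModule_injective S φ hφ hnat t (hinj t), fun y => ?_⟩
    let y' : k := (intervalSpace k S t).subtype y
    suffices ∃ x, φ t x = y' by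
      obtain ⟨x, hx⟩ := this
      exact ⟨x, Subtype.ext hx⟩
    by_cases ht : t ∈ S
    · obtain ⟨x, hx⟩ := hS t ht
      exact ⟨(y' / φ t x) • x, by rw [map_smul, smul_eq_mul, div_mul_cancel₀ _ hx]⟩
    · exact ⟨0, by rw [map_zero]; exact (intervalSpace_eq_zero ht y).symm⟩
  exact NatIso.isIso_of_isIso_app _

open Classical in
/-- The generator of the interval module at `t` (zero off the interval). -/
noncomputable def intervalOne (k : Type u) [Field k] (S : Set ℝ) (t : ℝ) : intervalSpace k S t :=
  ⟨if t ∈ S then 1 else 0, by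
    by_cases ht : t ∈ S
    · exact mem_intervalSpace ht
    · rw [if_neg ht]; exact Submodule.zero_mem _⟩

theorem intervalOne_eq_zero {S : Set ℝ} {t : ℝ} (ht : t ∉ S) : intervalOne k S t = 0 :=
  Subtype.ext (if_neg ht)

theorem eq_smul_intervalOne (S : Set ℝ) (t : ℝ) (x : intervalSpace k S t) :
    x = (x : k) • intervalOne k S t := by
  refine Subtype.ext ?_
  by_cases ht : t ∈ S
  · simp [intervalOne, ht]
  · simp [intervalSpace_eq_zero ht x]

theorem intervalMap_intervalOne {S : Set ℝ} {s t : ℝ} (hs : s ∈ S) :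
    intervalMap k S s t (intervalOne k S s) = intervalOne k S t := by
  refine Subtype.ext ?_
  rw [intervalMap_apply]
  simp [intervalOne, hs]

/-- With `VMinus_intervalModule`, this makes the source disappear: it puts its whole image into `Y⁺`
and nothing into `Y⁻`. -/
theorem VPlus_intervalModule {I : Interval} {t : ℝ} (ht : t ∈ I.toSet) :
    (VPlus (intervalModule k I.toSet) I).space t = ⊤ := by
  rw [VPlus_space_of_mem _ ht, eq_top_iff]
  rintro x -
  constructor
  · refine (mem_imPlus _).2 fun s hst hs => ?_
    refine ⟨(⟨(intervalSpace k I.toSet t).subtype x,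
      mem_intervalSpace ⟨hs.1, hs.2.trans ht.2⟩⟩ : intervalSpace k I.toSet s),
      Subtype.ext ?_⟩
    exact (intervalMap_apply _ _ _ _).trans (if_pos ht)
  · refine (mem_kerPlus _).2 fun r htr hr => ?_
    exact Subtype.ext (intervalSpace_eq_zero
      (fun H => lt_irrefl r (lt_of_plusPt_le_of_le_minusPt H.2 hr.1)) _)

theorem VMinus_intervalModule (I : Interval) (t : ℝ) :
    (VMinus (intervalModule k I.toSet) I).space t = ⊥ := by
  by_cases ht : t ∈ I.toSet
  · rw [VMinus_space_of_mem _ ht, eq_bot_iff]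
    refine sup_le (inf_le_left.trans ?_) (inf_le_right.trans ?_)
    · refine iSup_le fun s => iSup_le fun hst => iSup_le fun hs => ?_
      rintro _ ⟨y, rfl⟩
      rw [show y = 0 from Subtype.ext (intervalSpace_eq_zero
        (fun H => lt_irrefl s (lt_of_plusPt_le_of_le_minusPt hs.2 H.1)) y), map_zero]
      exact Submodule.zero_mem _
    · refine iSup_le fun r => iSup_le fun htr => iSup_le fun hr => ?_
      intro y hy
      refine (Submodule.mem_bot k).2 (Subtype.ext ?_)
      have hr' : r ∈ I.toSet := ⟨ht.1.trans hr.1, hr.2⟩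
      have hy' : intervalMap k I.toSet t r y = 0 := hy
      exact ((intervalMap_apply I.toSet t r y).trans (if_pos hr')).symm.trans
        (congrArg Subtype.val hy')
  · exact VMinus_space_of_notMem _ ht

/-! ### Morphisms from an interval module -/

section

variable {I : Interval} {U : PersistenceModule k} (f : intervalModule k I.toSet ⟶ U)

/-- The image of the generator at `t`. -/
noncomputable def imageOne (t : ℝ) : U.obj t := (f.app t).hom (intervalOne k I.toSet t)

theorem imageOne_eq_zero {t : ℝ} (ht : t ∉ I.toSet) : imageOne f t = 0 :=
  (congrArg (f.app t).hom (intervalOne_eq_zero ht)).trans (map_zero _)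

theorem app_eq_smul_imageOne (t : ℝ) (x : (intervalModule k I.toSet).obj t) :
    (f.app t).hom x = (intervalSpace k I.toSet t).subtype x • imageOne f t :=
  (congrArg (f.app t).hom (eq_smul_intervalOne I.toSet t x)).trans (map_smul _ _ _)

theorem ρ_imageOne {s t : ℝ} (hs : s ∈ I.toSet) (h : s ≤ t) :
    PersistenceModule.ρ U h (imageOne f s) = imageOne f t :=
  (PersistenceModule.app_ρ f h _).symm.trans
    (congrArg (f.app t).hom (intervalMap_intervalOne hs))

theorem map_VMinus_eq_bot (t : ℝ) :
    ((VMinus (intervalModule k I.toSet) I).map f).space t = ⊥ := by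
  change Submodule.map _ _ = _
  rw [VMinus_intervalModule, Submodule.map_bot]

theorem YMinus_space (J : Interval) (t : ℝ) :
    (YMinus f I J).space t = (VMinus U J).space t := by
  change _ ⊔ _ = _
  rw [map_VMinus_eq_bot, bot_sup_eq]

theorem exists_smul_of_mem_YPlus {J : Interval} {t : ℝ} {y : U.obj t}
    (hy : y ∈ (YPlus f I J).space t) : ∃ c : k, y = c • imageOne f t := by
  obtain ⟨⟨x, -, rfl⟩, -⟩ := hy
  exact ⟨_, app_eq_smul_imageOne f t x⟩

theorem imageOne_mem_YPlus {J : Interval} {t : ℝ} (ht : t ∈ I.toSet)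
    (h : imageOne f t ∈ (VPlus U J).space t) : imageOne f t ∈ (YPlus f I J).space t := by
  refine ⟨⟨intervalOne k I.toSet t, ?_, rfl⟩, h⟩
  rw [VPlus_intervalModule ht]
  exact Submodule.mem_top

/-- A nonzero element of `Y⁺(t)` puts `t` in both intervals and the generator in `U_J⁺`. -/
theorem of_mem_YPlus {J : Interval} {t : ℝ} {y : U.obj t}
    (hy : y ∈ (YPlus f I J).space t) (h0 : y ≠ 0) :
    t ∈ I.toSet ∧ t ∈ J.toSet ∧ imageOne f t ∈ (VPlus U J).space t := by
  obtain ⟨c, rfl⟩ := exists_smul_of_mem_YPlus f hy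
  obtain ⟨hc, hv⟩ := smul_ne_zero_iff.1 h0
  refine ⟨not_imp_comm.1 (imageOne_eq_zero f) hv, ?_, ?_⟩
  · by_contra ht
    have := hy.2
    rw [VPlus_space_of_notMem U ht] at this
    exact h0 ((Submodule.mem_bot k).1 this)
  · exact (Submodule.smul_mem_iff _ hc).1 hy.2

/-! ### Coefficients of the image of the generator, and the three claims -/

namespace PersistenceBasis

variable (β : PersistenceBasis U)

theorem mem_intervalsOf_iff {J : Interval} :
    J ∈ β.intervalsOf f ↔ ∃ t i, β.J i = J ∧ β.coord i t (imageOne f t) ≠ 0 := by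
  constructor
  · rintro ⟨t, x, i, hi, h⟩
    refine ⟨t, i, hi, fun h0 => (β.coord_ne_zero_iff i t _).2 h ?_⟩
    rw [app_eq_smul_imageOne, map_smul, h0, smul_zero]
  · rintro ⟨t, i, hi, h⟩
    exact ⟨t, _, i, hi, (β.coord_ne_zero_iff i t _).1 h⟩

variable {f} {β} {i : β.ι} {s t : ℝ}

theorem mem_of_coord_imageOne_ne_zero (h : β.coord i s (imageOne f s) ≠ 0) : s ∈ I.toSet := by
  by_contra hs
  exact h (by rw [imageOne_eq_zero f hs, map_zero])

/-- The generator at `s` comes from every earlier point of `I`, so its image lies in `Im⁺` for the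
left endpoint of `I`. -/
theorem left_le_of_coord_imageOne_ne_zero (h : β.coord i s (imageOne f s) ≠ 0) :
    (β.J i).left ≤ I.left := by
  have hs := mem_of_coord_imageOne_ne_zero h
  refine β.left_le_of_mem_imPlus (x := imageOne f s) ?_ h
  exact (mem_imPlus U).2 fun r hr hrs => ⟨imageOne f r, ρ_imageOne f ⟨hrs.1, hrs.2.trans hs.2⟩ hr⟩

/-- Coefficients that occur at all occur at every point of `I` before the right endpoint. -/
theorem coord_imageOne_ne_zero (h : β.coord i s (imageOne f s) ≠ 0) (ht : t ∈ I.toSet)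
    (htr : plusPt t ≤ (β.J i).right) : β.coord i t (imageOne f t) ≠ 0 := by
  have hs := mem_of_coord_imageOne_ne_zero h
  have htJ : t ∈ (β.J i).toSet := ⟨(left_le_of_coord_imageOne_ne_zero h).trans ht.1, htr⟩
  -- Forward, the coefficient is carried to `t ∈ J_i`; backward, the coefficient at `s ∈ J_i` is the
  -- one carried from `t`.
  rcases le_total s t with hst | hts
  · rwa [← ρ_imageOne f hs hst, β.coord_ρ_of_mem hst htJ]
  · rwa [← ρ_imageOne f ht hts, β.coord_ρ_of_mem hts (β.mem_of_coord_ne_zero h)] at h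

variable (f) (β)

theorem exists_isSmallestLastEnding (hf : f ≠ 0) :
    ∃ J, IsSmallestLastEnding (β.intervalsOf f) J := by
  obtain ⟨t, ht⟩ : ∃ t, imageOne f t ≠ 0 := by
    by_contra! H
    refine hf (NatTrans.ext (funext fun t => ModuleCat.hom_ext (LinearMap.ext fun x => ?_)))
    rw [app_eq_smul_imageOne, H, smul_zero]
    rfl
  -- Lexicographic maximum: the greatest right endpoint, then the greatest left endpoint, which is
  -- the smallest interval.
  obtain ⟨i, hi, hmax⟩ := Set.exists_max_image _
    (fun i => toLex ((β.J i).right, (β.J i).left))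
    (β.finite_coord_ne_zero t (imageOne f t)) (β.exists_coord_ne_zero ht)
  have htI := mem_of_coord_imageOne_ne_zero hi
  -- A competitor ending no earlier than `J_i` is already active at `t`, even if it was found at
  -- another time `s`.
  have key : ∀ {j s}, β.coord j s (imageOne f s) ≠ 0 → (β.J i).right ≤ (β.J j).right →
      (β.J j).right = (β.J i).right ∧ (β.J j).left ≤ (β.J i).left := by
    intro j s hj hij
    have hle := hmax j (coord_imageOne_ne_zero hj htI ((β.mem_of_coord_ne_zero hi).2.trans hij))
    rcases Prod.Lex.le_iff.1 hle with hlt | hle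
    · exact absurd hlt (not_lt_of_ge hij)
    · exact hle
  refine ⟨β.J i, (β.mem_intervalsOf_iff f).2 ⟨t, i, rfl, hi⟩, fun J' hJ' => ?_,
    fun J' hJ' hr => ?_⟩
  · obtain ⟨s, j, rfl, hj⟩ := (β.mem_intervalsOf_iff f).1 hJ'
    rcases le_total (β.J i).right (β.J j).right with h | h
    · exact (key hj h).1.le
    · exact h
  · obtain ⟨s, j, rfl, hj⟩ := (β.mem_intervalsOf_iff f).1 hJ'
    exact fun r hrr => ⟨(key hj hr.ge).2.trans hrr.1, hrr.2.trans hr.ge⟩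

theorem isSmallestLastEnding_of_not_isZero_X {J : Interval} (hX : ¬ Limits.IsZero (X f I J)) :
    IsSmallestLastEnding (β.intervalsOf f) J := by
  obtain ⟨t, y, hyP, hyM⟩ : ∃ t, ∃ y ∈ (YPlus f I J).space t, y ∉ (YMinus f I J).space t := by
    by_contra! H
    refine hX ((Functor.isZero_iff _).2 fun t => ?_)
    have : Subsingleton ((X f I J).obj t) := by
      refine subsingleton_of_forall_eq 0 fun z => ?_
      obtain ⟨⟨y, hy⟩, rfl⟩ := Submodule.Quotient.mk_surjective _ z
      exact (Submodule.Quotient.mk_eq_zero _).2 ⟨H t y hy, hy⟩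
    exact ModuleCat.isZero_of_subsingleton _
  rw [YMinus_space] at hyM
  have hy0 : y ≠ 0 := fun h => hyM (h ▸ Submodule.zero_mem _)
  obtain ⟨htI, htJ, hv⟩ := of_mem_YPlus f hyP hy0
  have hvM : imageOne f t ∉ (VMinus U J).space t := by
    obtain ⟨c, rfl⟩ := exists_smul_of_mem_YPlus f hyP
    exact fun h => hyM (Submodule.smul_mem _ c h)
  obtain ⟨i, hi, hiJ⟩ : ∃ i, β.coord i t (imageOne f t) ≠ 0 ∧ β.J i = J := by
    by_contra! H
    exact hvM (β.mem_VMinus_of_forall_ne htJ hv H)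
  rw [β.mem_VPlus_iff htJ] at hv
  refine ⟨(β.mem_intervalsOf_iff f).2 ⟨t, i, hiJ, hi⟩, fun J' hJ' => ?_, fun J' hJ' hr => ?_⟩
  · obtain ⟨s, j, rfl, hj⟩ := (β.mem_intervalsOf_iff f).1 hJ'
    -- Only intervals ending no earlier than `J` matter; they are active at `t`, where `hv` bounds
    -- both endpoints.
    rcases le_total J.right (β.J j).right with h | h
    · exact (hv j (coord_imageOne_ne_zero hj htI (htJ.2.trans h))).2
    · exact h
  · obtain ⟨s, j, rfl, hj⟩ := (β.mem_intervalsOf_iff f).1 hJ'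
    have := (hv j (coord_imageOne_ne_zero hj htI (htJ.2.trans hr.ge))).1
    exact fun r hrr => ⟨this.trans hrr.1, hrr.2.trans hr.ge⟩

/-- Near the right end of `I ∩ J̃`, the image of the generator lies in `U_{J̃}⁺`. -/
theorem exists_imageOne_mem_VPlus {J : Interval}
    (hJ : IsSmallestLastEnding (β.intervalsOf f) J) :
    ∃ t ∈ I.toSet ∩ J.toSet, imageOne f t ∈ (VPlus U J).space t := by
  obtain ⟨s, i, rfl, hi⟩ := (β.mem_intervalsOf_iff f).1 hJ.1
  have hsI := mem_of_coord_imageOne_ne_zero hi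
  have hsJ := β.mem_of_coord_ne_zero hi
  have hmem : ∀ {j r}, β.coord j r (imageOne f r) ≠ 0 → β.J j ∈ β.intervalsOf f :=
    fun h => (β.mem_intervalsOf_iff f).2 ⟨_, _, rfl, h⟩
  have hfin : {j | β.coord j s (imageOne f s) ≠ 0 ∧ (β.J j).right < (β.J i).right}.Finite :=
    (β.finite_coord_ne_zero s (imageOne f s)).subset fun j hj => hj.1
  -- Finitely many intervals are active at `s`, so some `t` before the end of `J_i` lies beyond all
  -- those that end earlier.
  obtain ⟨t, hst, htJ, htr⟩ : ∃ t, s ≤ t ∧ plusPt t ≤ (β.J i).right ∧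
      ∀ j, β.coord j s (imageOne f s) ≠ 0 → (β.J j).right < (β.J i).right →
        (β.J j).right ≤ minusPt t := by
    rcases Set.eq_empty_or_nonempty
      {j | β.coord j s (imageOne f s) ≠ 0 ∧ (β.J j).right < (β.J i).right} with hE | hE
    · exact ⟨s, le_rfl, hsJ.2, fun j h1 h2 => absurd (hE ▸ ⟨h1, h2⟩ : j ∈ (∅ : Set _)) id⟩
    · obtain ⟨j₀, hj₀, hmax⟩ := Set.exists_max_image _ (fun j => (β.J j).right) hfin hE
      obtain ⟨t, ht1, ht2⟩ := between_nonempty hj₀.2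
      exact ⟨t, (lt_of_plusPt_le_of_le_minusPt (β.mem_of_coord_ne_zero hj₀.1).2 ht1).le, ht2,
        fun j h1 h2 => (hmax j ⟨h1, h2⟩).trans ht1⟩
  have htJ' : t ∈ (β.J i).toSet := ⟨hsJ.1.trans (minusPt_mono hst), htJ⟩
  have htI : t ∈ I.toSet := by
    by_contra htI
    refine hi ?_
    rw [← β.coord_ρ_of_mem hst htJ', ρ_imageOne f hsI hst, imageOne_eq_zero f htI, map_zero]
  refine ⟨t, ⟨htI, htJ'⟩, (β.mem_VPlus_iff htJ').2 fun j hj => ?_⟩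
  have hr := hJ.2.1 _ (hmem hj)
  refine ⟨?_, hr⟩
  rcases hr.lt_or_eq with hr' | hr'
  · have hjs := coord_imageOne_ne_zero hj hsI ((plusPt_mono hst).trans
      (β.mem_of_coord_ne_zero hj).2)
    exact absurd (lt_of_plusPt_le_of_le_minusPt (β.mem_of_coord_ne_zero hj).2 (htr j hjs hr'))
      (lt_irrefl t)
  · exact Interval.left_le_of_toSet_subset (hJ.2.2 _ (hmem hj) hr')

/-- The functional on `X_{IJ}(t)` induced by the coefficient at an index `i` with `J_i = J`. -/
noncomputable def coordX (i : β.ι) (t : ℝ) : (X f I (β.J i)).obj t →ₗ[k] k :=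
  Submodule.liftQ _ (β.coord i t ∘ₗ ((YPlus f I (β.J i)).space t).subtype) <| by
    rintro ⟨y, hy⟩ h
    have h' : y ∈ (YMinus f I (β.J i)).space t := h.1
    rw [YMinus_space] at h'
    exact β.coord_eq_zero_of_mem_VMinus rfl h'

/-- One functional serves both targets: `coordX` is injective because the coefficient of `v` at `J`
vanishes nowhere on `I ∩ J`, and it is nonzero exactly over `K`. Landing in `k_K` it is an
isomorphism, landing in `k_{I ∩ J}` an embedding. -/
theorem exists_iso_X {J : Interval} (hJ : IsSmallestLastEnding (β.intervalsOf f) J) :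
    ∃ K : Interval, K.toSet ⊆ I.toSet ∩ J.toSet ∧
      Nonempty (X f I J ≅ intervalModule k K.toSet) ∧
      ∃ g : X f I J ⟶ intervalModule k (I.toSet ∩ J.toSet),
        ∀ t : ℝ, Function.Injective (g.app t).hom := by
  have hne := β.exists_imageOne_mem_VPlus f hJ
  obtain ⟨s, i, rfl, hi⟩ := (β.mem_intervalsOf_iff f).1 hJ.1
  -- `I ∩ J` is the set between the larger left and the smaller right endpoint; `K` is closed
  -- upwards in it because `U_J⁺` is a submodule.
  obtain ⟨K, hK⟩ := exists_interval_of_upper_part (a := max I.left (β.J i).left)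
    (d := min I.right (β.J i).right)
    (K := {t | t ∈ I.toSet ∩ (β.J i).toSet ∧ imageOne f t ∈ (VPlus U (β.J i)).space t})
    (by obtain ⟨t, h1, h2⟩ := hne; exact ⟨t, h1, h2⟩)
    (fun t ht => ⟨max_le ht.1.1.1 ht.1.2.1, le_min ht.1.1.2 ht.1.2.2⟩)
    (fun r hr t ht hrt => ⟨⟨⟨(le_max_left _ _).trans ht.1, ht.2.trans (min_le_left _ _)⟩,
      ⟨(le_max_right _ _).trans ht.1, ht.2.trans (min_le_right _ _)⟩⟩,
      ρ_imageOne f hr.1.1 hrt ▸ (VPlus U (β.J i)).map_mem hrt _ hr.2⟩)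
  have hKsub : K.toSet ⊆ I.toSet ∩ (β.J i).toSet := fun t ht => (hK ▸ ht : t ∈ {t | _}).1
  have hinj : ∀ t, Function.Injective (β.coordX f i t) := by
    intro t
    rw [injective_iff_map_eq_zero]
    intro z hz
    obtain ⟨⟨y, hy⟩, rfl⟩ := Submodule.Quotient.mk_surjective _ z
    suffices h : y = 0 by subst h; rfl
    by_contra h0
    obtain ⟨htI, htJ, -⟩ := of_mem_YPlus f hy h0
    obtain ⟨c, rfl⟩ := exists_smul_of_mem_YPlus f hy
    have hz' : β.coord i t (c • imageOne f t) = 0 := hz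
    rw [map_smul] at hz'
    exact smul_ne_zero (smul_ne_zero_iff.1 h0).1 (coord_imageOne_ne_zero hi htI htJ.2) hz'
  have hsupp : ∀ t z, β.coordX f i t z ≠ 0 → t ∈ K.toSet := by
    intro t z hz
    obtain ⟨⟨y, hy⟩, rfl⟩ := Submodule.Quotient.mk_surjective _ z
    obtain ⟨h1, h2, h3⟩ := of_mem_YPlus f hy fun h0 => hz ((congrArg (β.coord i t) h0).trans (map_zero _))
    rw [hK]
    exact ⟨⟨h1, h2⟩, h3⟩
  have hnat : ∀ {r t : ℝ} (h : r ≤ t) (z : (X f I (β.J i)).obj r),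
      t ∈ I.toSet ∩ (β.J i).toSet →
      β.coordX f i t (PersistenceModule.ρ (X f I (β.J i)) h z) = β.coordX f i r z := by
    intro r t h z ht
    obtain ⟨⟨y, hy⟩, rfl⟩ := Submodule.Quotient.mk_surjective _ z
    exact β.coord_ρ_of_mem h ht.2 y
  have hOrd : (I.toSet ∩ (β.J i).toSet).OrdConnected := inferInstance
  refine ⟨K, hKsub, ?_, toIntervalModule _ (β.coordX f i) (fun t z hz => hKsub (hsupp t z hz))
    hnat, fun t => toIntervalModule_injective _ _ _ _ t (hinj t)⟩
  have := isIso_toIntervalModule K.toSet (β.coordX f i) hsupp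
    (fun h z ht => hnat h z (hKsub ht)) hinj (by
      intro t ht
      have ht' := ht
      rw [hK] at ht'
      exact ⟨Submodule.Quotient.mk ⟨_, imageOne_mem_YPlus f ht'.1.1 ht'.2⟩,
        coord_imageOne_ne_zero hi ht'.1.1 ht'.1.2.2⟩)
  exact ⟨asIso (toIntervalModule K.toSet (β.coordX f i) hsupp
    (fun h z ht => hnat h z (hKsub ht)))⟩

end PersistenceBasis

end

end

end Persistence

/-- A smallest last-ending interval belongs to `intervalsOf f`, which already forces `f ≠ 0`; hence
the last two clauses speak of `IsSmallestLastEnding` alone. -/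
theorem mainTheorem9 {k : Type u} [Field k] (I : Persistence.Interval)
    (U : Persistence.PersistenceModule k) (β : Persistence.PersistenceBasis U)
    (f : Persistence.intervalModule k I.toSet ⟶ U) :
    (f ≠ 0 → ∃! J : Persistence.Interval,
      Persistence.IsSmallestLastEnding (β.intervalsOf f) J) ∧
    (∀ J : Persistence.Interval, ¬ Limits.IsZero (Persistence.X f I J) →
      Persistence.IsSmallestLastEnding (β.intervalsOf f) J) ∧
    (∀ J : Persistence.Interval, Persistence.IsSmallestLastEnding (β.intervalsOf f) J →
      ∃ K : Persistence.Interval, K.toSet ⊆ I.toSet ∩ J.toSet ∧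
        Nonempty (Persistence.X f I J ≅ Persistence.intervalModule k K.toSet) ∧
        ∃ g : Persistence.X f I J ⟶ Persistence.intervalModule k (I.toSet ∩ J.toSet),
          ∀ t : ℝ, Function.Injective (g.app t).hom) := by
  refine ⟨fun hf => ?_, fun J => β.isSmallestLastEnding_of_not_isZero_X f,
    fun J => β.exists_iso_X f⟩
  obtain ⟨J, hJ⟩ := β.exists_isSmallestLastEnding f hf
  exact ⟨J, hJ, fun J' hJ' => hJ'.eq hJ⟩
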